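/- Let $\zeta(s,x)$ ($0<x\le 1$) be the Hurwitz zeta function, $\zeta^{(k)}(0,x)=\frac{\partial^k}{\partial s^k}\zeta(s,x)\big|_{s=0}$, and let the generalised Stieltjes constants $\gamma_n(x)$ be defined by the Laurent expansion $$\zeta(s,x)=\frac1{s-1}+\sum_{n=0}^\infty\frac{(-1)^n}{n!}\gamma_n(x)(s-1)^n$$ at $s=1$; put $\gamma_n=\gamma_n(1)$, $\gamma=\gamma_0$ (Euler's constant), and $\zeta(s)=\zeta(s,1)$. Let $\psi=\Gamma'/\Gamma$. The complete Bell polynomials are $Y_0=1$ and $$Y_r(x_1,\dots,x_r)=\sum\frac{r!}{k_1!\cdots k_r!}\Big(\frac{x_1}{1!}\Big)^{k_1}\cdots\Big(\frac{x_r}{r!}\Big)^{k_r},$$ the sum being over all integers $k_1,\dots,k_r\ge0$ with $k_1+2k_2+\dots+rk_r=r$. For an integer $q\ge1$ put $$g_q(s)=\psi(1-s)+\tfrac12\psi(1+\tfrac s2)-\tfrac12\psi(1-\tfrac s2)-\log(2\pi q),$$ $$h_q(s)=\psi(1+s)-\tfrac12\psi(1+\tfrac s2)+\tfrac12\psi(1-\tfrac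 s2)-\log(2\pi q),$$ and write $\mathbf Y_i(f)=Y_i(f(0),f'(0),\dots,f^{(i-1)}(0))$ for $f=g_q$ or $f=h_q$. Put also $\mathbf Y_i^*=Y_i(\gamma+\log(2\pi q),1!\,\zeta(2),2!\,\zeta(3),\dots,(i-1)!\,\zeta(i))$. Let $1\le p\le q$ and $n\ge1$ be integers, and for $1\le r\le q$, $0\le i\le n$ let $$T_{r,i}=\binom ni\Big[\mathbf Y_i(g_q)\cos\Big(\frac{2\pi rp}q\Big)+\frac\pi2\,i\,\mathbf Y_{i-1}(h_q)\sin\Big(\frac{2\pi rp}q\Big)\Big]\zeta^{(n-i)}\Big(0,\frac rq\Big),$$ where for $i=0$ the second term in the bracket is $0$. Then $$n\gamma_{n-1}\Big(\frac pq\Big)=2\sum_{r=1}^q\sum_{i=0}^nT_{r,i};$$ $$n\gamma_{n-1}\Big(\frac pq\Big)=2\sum_{r=1}^q\sum_{i=0}^n\binom ni\mathbf Y_i^*\sum_{j=0}^{n-i}\binom{n-i}j(-1)^{n-j}\Big(\frac\pi2\Big)^{n-i-j}\cos\Big(\frac{2\pi rp}q+\frac{\pi(n-i-j)}2\Big)\zeta^{(j)}\Big(0,\frac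 rq\Big);$$ and, subtracting from the first formula its case $p=q=1$, $$n\gamma_{n-1}\Big(\frac pq\Big)=n\gamma_{n-1}+2\sum_{i=0}^n\binom ni\big[\mathbf Y_i(g_q)-\mathbf Y_i(g_1)\big]\zeta^{(n-i)}(0)+2\sum_{r=1}^{q-1}\sum_{i=0}^nT_{r,i}.$$ -/

import Mathlib

noncomputable section

namespace StieltjesRational

open scoped Nat

/-- The Hurwitz zeta function `ζ(s, x)` for `0 < x ≤ 1`: the meromorphic continuation of
`∑ k, 1 / (k + x) ^ s`. Mathlib's `HurwitzZeta.hurwitzZeta` takes its parameter in `ℝ / ℤ`; on the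
representatives in `(0, 1]` it is the classical function (`x = 1` gives the Riemann zeta
function). -/
def hurwitz (x : ℝ) (s : ℂ) : ℂ :=
  HurwitzZeta.hurwitzZeta (x : UnitAddCircle) s

/-- The derivative `ζ^(k)(0, x)` of order `k` in the variable `s`, at `s = 0`. -/
def hurwitzDerivZero (k : ℕ) (x : ℝ) : ℂ :=
  iteratedDeriv k (hurwitz x) 0

/-- `ζ(s, x) - 1 / (s - 1)`, extended to the removable singularity `s = 1` by its limit there. -/
def hurwitzRegular (x : ℝ) : ℂ → ℂ :=
  Function.update (fun s : ℂ => hurwitz x s - 1 / (s - 1)) 1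
    (Filter.limUnder (nhdsWithin (1 : ℂ) {1}ᶜ) fun s : ℂ => hurwitz x s - 1 / (s - 1))

/-- The generalised Stieltjes constant `γ_n(x)`, `0 < x ≤ 1`, that is, the coefficient in the
Laurent expansion `ζ(s, x) = 1 / (s - 1) + ∑ n, (-1) ^ n / n! * γ_n(x) * (s - 1) ^ n` at `s = 1`,
obtained as a Taylor coefficient of the regular part. -/
def stieltjes (n : ℕ) (x : ℝ) : ℂ :=
  (-1) ^ n * iteratedDeriv n (hurwitzRegular x) 1

/-- The (exponential) complete Bell polynomial `Y_r(x_1, …, x_r)`, as a sum over all partitions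
of `r`; `k_j` is the multiplicity of the part `j`. The arguments are indexed from `1`. -/
def completeBell (r : ℕ) (x : ℕ → ℂ) : ℂ :=
  ∑ π : Nat.Partition r,
    (r ! : ℂ) * ∏ j ∈ Finset.Icc 1 r,
      (x j / (j ! : ℂ)) ^ (π.parts.count j) / ((π.parts.count j)! : ℂ)

/-- `Y_i(f(0), f'(0), …, f^(i-1)(0))`. -/
def bellDerivZero (i : ℕ) (f : ℂ → ℂ) : ℂ :=
  completeBell i fun j => iteratedDeriv (j - 1) f 0

/-- `g(s) = ψ(1 - s) + ψ(1 + s/2) / 2 - ψ(1 - s/2) / 2 - log (2πq)`. -/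
def gFun (q : ℕ) (s : ℂ) : ℂ :=
  Complex.digamma (1 - s) + 1 / 2 * Complex.digamma (1 + s / 2)
    - 1 / 2 * Complex.digamma (1 - s / 2) - (Real.log (2 * Real.pi * q) : ℂ)

/-- `h(s) = ψ(1 + s) - ψ(1 + s/2) / 2 + ψ(1 - s/2) / 2 - log (2πq)`. -/
def hFun (q : ℕ) (s : ℂ) : ℂ :=
  Complex.digamma (1 + s) - 1 / 2 * Complex.digamma (1 + s / 2)
    + 1 / 2 * Complex.digamma (1 - s / 2) - (Real.log (2 * Real.pi * q) : ℂ)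

/-- `Y_i(γ + log (2πq), 1! ζ(2), 2! ζ(3), …, (i-1)! ζ(i))`. -/
def bellStar (q i : ℕ) : ℂ :=
  completeBell i fun j =>
    if j = 1 then ((Real.eulerMascheroniConstant + Real.log (2 * Real.pi * q) : ℝ) : ℂ)
    else ((j - 1)! : ℂ) * riemannZeta j

/-- The summand of index `(r, i)`:
`C(n,i) [Y_i(g(0)) cos (2πrp/q) + (π/2) i Y_{i-1}(h(0)) sin (2πrp/q)] ζ^(n-i)(0, r/q)`.
For `i = 0` the factor `i` removes the second term. -/
def summand (n p q r i : ℕ) : ℂ :=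
  (n.choose i : ℂ) *
    (bellDerivZero i (gFun q) * (Real.cos (2 * Real.pi * r * p / q) : ℂ)
      + (Real.pi / 2 : ℂ) * (i : ℂ) * bellDerivZero (i - 1) (hFun q)
          * (Real.sin (2 * Real.pi * r * p / q) : ℂ))
    * hurwitzDerivZero (n - i) ((r : ℝ) / q)

end StieltjesRational

end

/-!
The formulas are Taylor coefficients at `s = 0` of the functional equation of the Hurwitz zeta
function at a rational parameter (`mul_hurwitz_one_sub`),
`s ζ(1 - s, p/q) = 2 Γ(1 + s) (2πq) ^ (-s) ∑ r, cos (πs/2 - 2πrp/q) ζ(s, r/q)`.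
It holds for `s ≠ 0` close to `0`, and both sides continue analytically to `s = 0`, so they have the
same derivatives there (`hurwitzReflected_eventuallyEq`). Since `s ζ(1 - s, x)` is
`-1 + ∑ n, γ_n(x) s ^ (n + 1) / n!`, the derivative of order `n` on the left is `n γ_{n-1}(p/q)`
(`iteratedDeriv_hurwitzReflected`); on the right Leibniz's rule splits off the derivatives of
`ζ(s, r/q)`.

The remaining factors are exponentials of primitives of the functions `g`, `h` of the statement. If
`F(0) = 1` and `F' = f F`, Leibniz's rule gives the derivatives of `F` at `0` the same recurrence
that the complete Bell polynomials satisfy (`completeBell_succ`), whence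
`iteratedDeriv_eq_bellDerivZero`.

* For the first formula, `cos (πs/2 - θ)` is expanded. By the reflection formula the cosine part of
  the Gamma factor is `Γ(1 + s/2) Γ(1 - s/2) (2πq) ^ (-s) / Γ(1 - s)`, whose logarithmic derivative
  is visibly `g`, and the sine part is `πs/2` times
  `Γ(1 + s) (2πq) ^ (-s) / (Γ(1 + s/2) Γ(1 - s/2))`, whose logarithmic derivative is `h`
  (`gammaFactor_mul_cos_sub`). No identity between values of `ψ` is needed.
* For the second formula, `Γ(1 - s) = exp (γ s + ∑ m ≥ 2, ζ(m) s ^ m / m)`, which follows from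
  Euler's limit formula for `Γ` (`Gamma_one_sub_eq_cexp`), and the cosine is differentiated directly.
* The third formula subtracts from the first its case `p = q = 1`: in the term `r = q` the sine
  vanishes and `ζ(s, 1) = ζ(s)`.
-/

namespace StieltjesRational

open Finset Filter Topology
open scoped Nat

/-! ### Complete Bell polynomials -/

/-- The weight `∏ i, y_i ^ k_i / k_i!` of a multiset of natural numbers in which `i` occurs `k_i`
times; only the parts `1, …, N` are taken into account. -/
noncomputable def bellWeight (N : ℕ) (y : ℕ → ℂ) (s : Multiset ℕ) : ℂ :=
  ∏ i ∈ Icc 1 N, y i ^ s.count i / ((s.count i)! : ℂ)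

lemma count_mul_bellWeight_cons {N j : ℕ} (hj : j ∈ Icc 1 N) (y : ℕ → ℂ) (s : Multiset ℕ) :
    ((j ::ₘ s).count j : ℂ) * bellWeight N y (j ::ₘ s) = y j * bellWeight N y s := by
  unfold bellWeight
  rw [← mul_prod_erase _ _ hj, ← mul_prod_erase _ (fun i => y i ^ s.count i / ((s.count i)! : ℂ)) hj]
  have h : ∀ i ∈ (Icc 1 N).erase j, y i ^ (j ::ₘ s).count i / (((j ::ₘ s).count i)! : ℂ)
      = y i ^ s.count i / ((s.count i)! : ℂ) := by
    intro i hi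
    rw [Multiset.count_cons_of_ne (ne_of_mem_erase hi)]
  rw [prod_congr rfl h, Multiset.count_cons_self, Nat.factorial_succ, pow_succ]
  have h1 : ((s.count j)! : ℂ) ≠ 0 := Nat.cast_ne_zero.mpr (Nat.factorial_ne_zero _)
  have h2 : ((s.count j + 1 : ℕ) : ℂ) ≠ 0 := Nat.cast_ne_zero.mpr (Nat.succ_ne_zero _)
  push_cast at h2 ⊢
  field_simp

/-- Adding one part `j` is a bijection from the partitions of `r - j` to the partitions of `r` that
contain `j`. -/
lemma sum_count_mul_bellWeight {N j r : ℕ} (hj : j ∈ Icc 1 N) (hjr : j ≤ r) (y : ℕ → ℂ) :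
    ∑ π : Nat.Partition r, (π.parts.count j : ℂ) * bellWeight N y π.parts =
      y j * ∑ π : Nat.Partition (r - j), bellWeight N y π.parts := by
  have hj1 : 1 ≤ j := (mem_Icc.mp hj).1
  rw [mul_sum]
  symm
  refine sum_of_injOn
    (fun π : Nat.Partition (r - j) => (⟨j ::ₘ π.parts, fun {i} hi => ?_, ?_⟩ : Nat.Partition r))
    ?_ (fun _ _ => mem_coe.mpr (mem_univ _)) ?_ ?_
  · rcases Multiset.mem_cons.mp hi with rfl | hi
    · exact hj1
    · exact π.parts_pos hi
  · rw [Multiset.sum_cons, π.parts_sum]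
    omega
  · intro π _ π' _ h
    have := congrArg Nat.Partition.parts h
    exact Nat.Partition.ext (by simpa using this)
  · intro π _ hπ
    by_contra hne
    have hmem : j ∈ π.parts := by
      by_contra hnot
      exact hne (by simp [Multiset.count_eq_zero_of_notMem hnot])
    refine hπ ⟨⟨π.parts.erase j, fun {i} hi => π.parts_pos (Multiset.mem_of_mem_erase hi), ?_⟩,
      mem_coe.mpr (mem_univ _), Nat.Partition.ext (by simp [Multiset.cons_erase hmem])⟩
    have := π.parts_sum
    rw [← Multiset.cons_erase hmem, Multiset.sum_cons] at this
    omega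
  · intro π _
    exact (count_mul_bellWeight_cons hj y π.parts).symm

lemma sum_mul_count_parts {r : ℕ} (π : Nat.Partition r) :
    ∑ j ∈ Icc 1 r, j * π.parts.count j = r := by
  have hsub : π.parts.toFinset ⊆ Icc 1 r := by
    intro i hi
    rw [Multiset.mem_toFinset] at hi
    exact mem_Icc.mpr ⟨π.parts_pos hi, π.parts_sum ▸ Multiset.le_sum_of_mem hi⟩
  conv_rhs => rw [← π.parts_sum, Finset.sum_multiset_count_of_subset _ _ hsub]
  exact sum_congr rfl fun j _ => by rw [smul_eq_mul, mul_comm]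

lemma completeBell_eq_sum_bellWeight {r N : ℕ} (h : r ≤ N) (x : ℕ → ℂ) :
    completeBell r x =
      (r ! : ℂ) * ∑ π : Nat.Partition r, bellWeight N (fun j => x j / (j ! : ℂ)) π.parts := by
  unfold completeBell bellWeight
  rw [mul_sum]
  refine sum_congr rfl fun π _ => ?_
  congr 1
  refine prod_subset (Icc_subset_Icc_right h) fun i hi hi' => ?_
  have : i ∉ π.parts := fun hmem => hi' <| mem_Icc.mpr
    ⟨(mem_Icc.mp hi).1, π.parts_sum ▸ Multiset.le_sum_of_mem hmem⟩
  simp [Multiset.count_eq_zero_of_notMem this]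

lemma completeBell_zero (x : ℕ → ℂ) : completeBell 0 x = 1 := by
  simp [completeBell]

/-- The argument of index `0` does not enter the complete Bell polynomials. -/
lemma completeBell_congr {r : ℕ} {x y : ℕ → ℂ} (h : ∀ j, 1 ≤ j → x j = y j) :
    completeBell r x = completeBell r y := by
  unfold completeBell
  refine sum_congr rfl fun π _ => ?_
  congr 1
  exact prod_congr rfl fun j hj => by rw [h j (mem_Icc.mp hj).1]

/-- The recurrence of the complete Bell polynomials. It comes from writing the number `n + 1`, for
each of its partitions, as the sum of `j` times the multiplicity of `j`. -/
lemma completeBell_succ (n : ℕ) (x : ℕ → ℂ) :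
    completeBell (n + 1) x =
      ∑ k ∈ range (n + 1), (n.choose k : ℂ) * x (k + 1) * completeBell (n - k) x := by
  set y : ℕ → ℂ := fun j => x j / (j ! : ℂ) with hy
  have key : ((n + 1 : ℕ) : ℂ) * ∑ π : Nat.Partition (n + 1), bellWeight (n + 1) y π.parts =
      ∑ k ∈ range (n + 1), ((k + 1 : ℕ) : ℂ) *
        (y (k + 1) * ∑ π : Nat.Partition (n - k), bellWeight (n + 1) y π.parts) := by
    calc
      _ = ∑ π : Nat.Partition (n + 1), ∑ j ∈ Icc 1 (n + 1),
            (j : ℂ) * ((π.parts.count j : ℂ) * bellWeight (n + 1) y π.parts) := by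
        rw [mul_sum]
        refine sum_congr rfl fun π _ => ?_
        have hsum : ((n + 1 : ℕ) : ℂ) = ∑ j ∈ Icc 1 (n + 1), (j : ℂ) * (π.parts.count j : ℂ) := by
          exact_mod_cast (sum_mul_count_parts π).symm
        rw [hsum, sum_mul]
        exact sum_congr rfl fun j _ => mul_assoc _ _ _
      _ = ∑ j ∈ Icc 1 (n + 1), (j : ℂ) *
            (y j * ∑ π : Nat.Partition (n + 1 - j), bellWeight (n + 1) y π.parts) := by
        rw [sum_comm]
        refine sum_congr rfl fun j hj => ?_
        rw [← mul_sum, sum_count_mul_bellWeight hj (mem_Icc.mp hj).2]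
      _ = _ := by
        rw [range_eq_Ico, ← Ico_add_one_right_eq_Icc]
        rw [← zero_add 1, ← sum_Ico_add' _ 0 (n + (0 + 1)) (0 + 1)]
        refine sum_congr rfl fun k _ => ?_
        rw [zero_add, Nat.add_sub_add_right]
  rw [completeBell_eq_sum_bellWeight le_rfl, Nat.factorial_succ, Nat.cast_mul, mul_right_comm, key,
    sum_mul]
  refine sum_congr rfl fun k hk => ?_
  have hk' : k ≤ n := Nat.lt_succ_iff.mp (mem_range.mp hk)
  rw [completeBell_eq_sum_bellWeight (show n - k ≤ n + 1 by omega), ← hy,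
    Nat.cast_choose ℂ hk']
  simp only [hy, Nat.factorial_succ k]
  have h1 : (k ! : ℂ) ≠ 0 := Nat.cast_ne_zero.mpr (Nat.factorial_ne_zero _)
  have h2 : ((n - k)! : ℂ) ≠ 0 := Nat.cast_ne_zero.mpr (Nat.factorial_ne_zero _)
  have h3 : ((k + 1 : ℕ) : ℂ) ≠ 0 := Nat.cast_ne_zero.mpr (Nat.succ_ne_zero _)
  push_cast at h3 ⊢
  field_simp

/-! ### Derivatives of exponentials -/

/-- If `F' = f F` near `0` and `F(0) = 1`, so that `F` is the exponential of the primitive of `f`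
vanishing at `0`, then the derivatives of `F` at `0` are the complete Bell polynomials in the
derivatives of `f`. -/
lemma iteratedDeriv_eq_bellDerivZero {F f : ℂ → ℂ} (hF : AnalyticAt ℂ F 0) (hf : AnalyticAt ℂ f 0)
    (h0 : F 0 = 1) (h : deriv F =ᶠ[𝓝 0] fun s => f s * F s) (i : ℕ) :
    iteratedDeriv i F 0 = bellDerivZero i f := by
  induction i using Nat.strong_induction_on with
  | _ i ih =>
    rcases i with _ | n
    · simp [bellDerivZero, completeBell_zero, h0]
    · have h' : deriv F =ᶠ[𝓝 0] f * F := h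
      rw [iteratedDeriv_succ', h'.iteratedDeriv_eq, iteratedDeriv_mul hf.contDiffAt hF.contDiffAt,
        bellDerivZero, completeBell_succ]
      refine sum_congr rfl fun k hk => ?_
      rw [ih (n - k) (by omega), bellDerivZero, Nat.add_sub_cancel]

lemma iteratedDeriv_cexp_eq_completeBell {F P : ℂ → ℂ} (hP : AnalyticAt ℂ P 0) (h0 : P 0 = 0)
    (h : F =ᶠ[𝓝 0] fun s => Complex.exp (P s)) (i : ℕ) :
    iteratedDeriv i F 0 = completeBell i fun j => iteratedDeriv j P 0 := by
  rw [h.iteratedDeriv_eq, iteratedDeriv_eq_bellDerivZero (f := deriv P) (by fun_prop) hP.deriv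
    (by simp [h0])]
  · refine completeBell_congr fun j hj => ?_
    rw [← iteratedDeriv_succ', Nat.sub_add_cancel hj]
  · filter_upwards [hP.eventually_analyticAt] with s hs
    rw [(hs.differentiableAt.hasDerivAt.cexp).deriv, mul_comm]

/-! ### Taylor expansion of the logarithm of the Gamma function -/

lemma eventually_norm_lt_one : ∀ᶠ s in 𝓝 (0 : ℂ), ‖s‖ < 1 := by
  filter_upwards [Metric.ball_mem_nhds (0 : ℂ) one_pos] with s hs using mem_ball_zero_iff.mp hs

/-- A convergent power series is the Taylor series of its sum. -/
lemma iteratedDeriv_of_hasSum {f : ℂ → ℂ} {c : ℕ → ℂ}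
    (h : ∀ᶠ s in 𝓝 (0 : ℂ), HasSum (fun m => c m * s ^ m) (f s)) :
    AnalyticAt ℂ f 0 ∧ ∀ m, iteratedDeriv m f 0 = (m ! : ℂ) * c m := by
  have hp : HasFPowerSeriesAt f (FormalMultilinearSeries.ofScalars ℂ c) 0 := by
    rw [hasFPowerSeriesAt_iff]
    filter_upwards [h] with s hs
    simpa [FormalMultilinearSeries.coeff_ofScalars, mul_comm] using hs
  refine ⟨hp.analyticAt, fun m => ?_⟩
  have h2 := congrArg (fun p : FormalMultilinearSeries ℂ ℂ ℂ => p.coeff m)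
    (hp.eq_formalMultilinearSeries hp.analyticAt.hasFPowerSeriesAt)
  simp only [FormalMultilinearSeries.coeff_ofScalars] at h2
  rw [h2, mul_div_cancel₀]
  exact_mod_cast Nat.factorial_ne_zero m

/-- The double series `∑ (s / (k + 1)) ^ (m + 2) / (m + 2)` converges absolutely for `|s| < 1`.
Its sum over `m` is `-log (1 - s / (k + 1)) - s / (k + 1)` and its sum over `k` is
`ζ(m + 2) s ^ (m + 2) / (m + 2)`. -/
lemma exists_hasSum_log_and_zeta {s : ℂ} (hs : ‖s‖ < 1) :
    ∃ T : ℂ,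
      HasSum (fun k : ℕ => -Complex.log (1 - s / ((k + 1 : ℕ) : ℂ)) - s / ((k + 1 : ℕ) : ℂ)) T ∧
      HasSum (fun m : ℕ => riemannZeta ((m + 2 : ℕ) : ℂ) / ((m + 2 : ℕ) : ℂ) * s ^ (m + 2)) T := by
  set a : ℕ × ℕ → ℂ := fun x => (s / ((x.1 + 1 : ℕ) : ℂ)) ^ (x.2 + 2) / ((x.2 + 2 : ℕ) : ℂ)
  have hsq : Summable fun k : ℕ => 1 / ((k + 1 : ℕ) : ℝ) ^ 2 :=
    (summable_nat_add_iff 1).mpr (Real.summable_one_div_nat_pow.mpr one_lt_two)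
  have ha : Summable a := by
    refine Summable.of_norm_bounded
      (hsq.mul_of_nonneg (summable_geometric_of_lt_one (norm_nonneg s) hs) (fun _ => by positivity)
        (fun _ => by positivity)) ?_
    rintro ⟨k, m⟩
    have hk : (1 : ℝ) ≤ ((k + 1 : ℕ) : ℝ) := by exact_mod_cast Nat.le_add_left 1 k
    have hm : (1 : ℝ) ≤ ((m + 2 : ℕ) : ℝ) := by exact_mod_cast (by omega : 1 ≤ m + 2)
    simp only [a, norm_div, norm_pow, Complex.norm_natCast, div_pow]
    calc ‖s‖ ^ (m + 2) / ((k + 1 : ℕ) : ℝ) ^ (m + 2) / ((m + 2 : ℕ) : ℝ)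
        ≤ ‖s‖ ^ (m + 2) / ((k + 1 : ℕ) : ℝ) ^ (m + 2) := div_le_self (by positivity) hm
      _ ≤ ‖s‖ ^ m / ((k + 1 : ℕ) : ℝ) ^ 2 :=
        div_le_div₀ (by positivity) (pow_le_pow_of_le_one (norm_nonneg s) hs.le (by omega))
          (by positivity) (pow_le_pow_right₀ hk (by omega))
      _ = 1 / ((k + 1 : ℕ) : ℝ) ^ 2 * ‖s‖ ^ m := by ring
  refine ⟨∑' x, a x, ha.hasSum.prod_fiberwise fun k => ?_,
    ((Equiv.prodComm ℕ ℕ).hasSum_iff.mpr ha.hasSum).prod_fiberwise fun m => ?_⟩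
  · have hk : ‖s / ((k + 1 : ℕ) : ℂ)‖ < 1 := by
      rw [norm_div, Complex.norm_natCast]
      refine (div_le_self (norm_nonneg s) ?_).trans_lt hs
      exact_mod_cast Nat.le_add_left 1 k
    have := (hasSum_nat_add_iff' 2).mpr (Complex.hasSum_taylorSeries_neg_log hk)
    simpa [sum_range_succ, a] using this
  · have hz : HasSum (fun k : ℕ => 1 / ((k + 1 : ℕ) : ℂ) ^ (m + 2))
        (riemannZeta ((m + 2 : ℕ) : ℂ)) := by
      have hsum : Summable fun k : ℕ => 1 / (k : ℂ) ^ (m + 2) :=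
        by
        refine Summable.of_norm ?_
        simp
      have := (hasSum_nat_add_iff' 1).mpr hsum.hasSum
      rw [← zeta_nat_eq_tsum_of_gt_one (by omega)] at this
      simpa using this
    have := hz.mul_left (s ^ (m + 2) / ((m + 2 : ℕ) : ℂ))
    rw [mul_comm (_ / _), ← mul_div_assoc, mul_div_right_comm] at this
    refine this.congr_fun fun k => ?_
    simp only [Function.comp, Equiv.prodComm_apply, Prod.swap, a, div_pow]
    ring

/-- The Taylor expansion of `log Γ(1 - s)` at `0`, in exponential form. It comes from Euler's limit
formula for the Gamma function. -/
lemma Gamma_one_sub_eq_cexp {s T : ℂ} (hs : ‖s‖ < 1)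
    (hT : HasSum (fun k : ℕ => -Complex.log (1 - s / ((k + 1 : ℕ) : ℂ)) - s / ((k + 1 : ℕ) : ℂ))
      T) :
    Complex.Gamma (1 - s) = Complex.exp ((Real.eulerMascheroniConstant : ℂ) * s + T) := by
  rcases eq_or_ne s 0 with rfl | hs0
  · have : T = 0 := hT.unique (by simp)
    simp [this]
  have h1 : Tendsto (fun n => -s * Complex.GammaSeq (-s) n) atTop (𝓝 (Complex.Gamma (1 - s))) := by
    have := (Complex.GammaSeq_tendsto_Gamma (-s)).const_mul (-s)
    rwa [← Complex.Gamma_add_one _ (neg_ne_zero.mpr hs0), neg_add_eq_sub] at this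
  have h2 : Tendsto (fun n : ℕ => Complex.exp (((harmonic n - Real.log n : ℝ) : ℂ) * s +
      ∑ k ∈ range n, (-Complex.log (1 - s / ((k + 1 : ℕ) : ℂ)) - s / ((k + 1 : ℕ) : ℂ)))) atTop
      (𝓝 (Complex.exp ((Real.eulerMascheroniConstant : ℂ) * s + T))) :=
    (Complex.continuous_exp.tendsto _).comp
      ((((Complex.continuous_ofReal.tendsto _).comp Real.tendsto_harmonic_sub_log).mul_const s).add
        hT.tendsto_sum_nat)
  refine tendsto_nhds_unique h1 (h2.congr' ?_)
  filter_upwards [eventually_ne_atTop 0] with n hn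
  have hn' : (n : ℂ) ≠ 0 := Nat.cast_ne_zero.mpr hn
  have hk0 : ∀ k : ℕ, ((k + 1 : ℕ) : ℂ) ≠ 0 := fun k => Nat.cast_ne_zero.mpr (Nat.succ_ne_zero k)
  have hne : ∀ k : ℕ, ((k + 1 : ℕ) : ℂ) - s ≠ 0 := by
    intro k h
    rw [← sub_eq_zero.mp h, Complex.norm_natCast] at hs
    exact absurd hs (not_lt.mpr (by exact_mod_cast Nat.le_add_left 1 k))
  -- exponentiating the partial sums turns the logarithms into the product in Euler's sequence
  have hexp : Complex.exp (((harmonic n - Real.log n : ℝ) : ℂ) * s +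
      ∑ k ∈ range n, (-Complex.log (1 - s / ((k + 1 : ℕ) : ℂ)) - s / ((k + 1 : ℕ) : ℂ))) =
      (n : ℂ) ^ (-s) * ∏ k ∈ range n, (((k + 1 : ℕ) : ℂ) / (((k + 1 : ℕ) : ℂ) - s)) := by
    have hH : ((harmonic n : ℝ) : ℂ) * s = ∑ k ∈ range n, s / ((k + 1 : ℕ) : ℂ) := by
      simp [harmonic, sum_mul, div_eq_inv_mul]
    have hsplit : ((harmonic n - Real.log n : ℝ) : ℂ) * s +
        ∑ k ∈ range n, (-Complex.log (1 - s / ((k + 1 : ℕ) : ℂ)) - s / ((k + 1 : ℕ) : ℂ)) =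
        Complex.log n * (-s) + ∑ k ∈ range n, -Complex.log (1 - s / ((k + 1 : ℕ) : ℂ)) := by
      rw [sum_sub_distrib, ← hH, Complex.ofReal_sub, Complex.natCast_log]
      ring
    rw [hsplit, Complex.exp_add, ← Complex.cpow_def_of_ne_zero hn', Complex.exp_sum]
    congr 1
    refine prod_congr rfl fun k _ => ?_
    have h3 : 1 - s / ((k + 1 : ℕ) : ℂ) = (((k + 1 : ℕ) : ℂ) - s) / ((k + 1 : ℕ) : ℂ) := by
      rw [sub_div, div_self (hk0 k)]
    rw [Complex.exp_neg, h3, Complex.exp_log (div_ne_zero (hne k) (hk0 k)), inv_div]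
  rw [hexp, Complex.GammaSeq, prod_range_succ', Nat.cast_zero, add_zero, prod_div_distrib,
    ← prod_range_add_one_eq_factorial]
  have h4 : ∏ k ∈ range n, (-s + ((k + 1 : ℕ) : ℂ)) = ∏ k ∈ range n, (((k + 1 : ℕ) : ℂ) - s) :=
    prod_congr rfl fun k _ => by ring
  have h5 : ∏ k ∈ range n, (((k + 1 : ℕ) : ℂ) - s) ≠ 0 := prod_ne_zero_iff.mpr fun k _ => hne k
  rw [h4, Nat.cast_prod]
  field_simp

/-- The derivatives at `0` of `Γ(1 - s) (2πq) ^ s`. -/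
lemma iteratedDeriv_Gamma_one_sub_mul_cexp (q i : ℕ) :
    iteratedDeriv i (fun s => Complex.Gamma (1 - s) *
      Complex.exp ((Real.log (2 * Real.pi * q) : ℂ) * s)) 0 = bellStar q i := by
  -- the Taylor coefficients of `log Γ(1 - s) + s log (2πq)`
  set c : ℕ → ℂ := fun m => if m = 0 then 0 else
    if m = 1 then ((Real.eulerMascheroniConstant + Real.log (2 * Real.pi * q) : ℝ) : ℂ)
    else riemannZeta m / m with hc
  set P : ℂ → ℂ := fun s => ∑' m, c m * s ^ m with hP
  have hball := eventually_norm_lt_one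
  have key : ∀ s : ℂ, ‖s‖ < 1 → HasSum (fun m => c m * s ^ m) (P s) ∧
      Complex.Gamma (1 - s) * Complex.exp ((Real.log (2 * Real.pi * q) : ℂ) * s) =
        Complex.exp (P s) := by
    intro s hs
    obtain ⟨T, hT1, hT2⟩ := exists_hasSum_log_and_zeta hs
    have hsum : HasSum (fun m => c m * s ^ m)
        ((Real.eulerMascheroniConstant + Real.log (2 * Real.pi * q) : ℂ) * s + T) := by
      rw [← hasSum_nat_add_iff' 2]
      simpa [hc, sum_range_succ] using hT2
    refine ⟨hsum.summable.hasSum, ?_⟩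
    rw [show P s = _ from hsum.tsum_eq, Gamma_one_sub_eq_cexp hs hT1, ← Complex.exp_add]
    congr 1
    ring
  obtain ⟨han, hder⟩ := iteratedDeriv_of_hasSum (hball.mono fun s hs => (key s hs).1)
  rw [iteratedDeriv_cexp_eq_completeBell han (by simpa [hc] using hder 0)
    (hball.mono fun s hs => (key s hs).2), bellStar]
  refine completeBell_congr fun j hj => ?_
  rw [hder j]
  rcases eq_or_ne j 1 with rfl | hj1
  · simp [hc]
  · simp only [hc, if_neg hj1, if_neg (show j ≠ 0 by omega)]
    have hj0 : (j : ℂ) ≠ 0 := Nat.cast_ne_zero.mpr (by omega)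
    rw [← Nat.mul_factorial_pred (show j ≠ 0 by omega), Nat.cast_mul]
    field_simp

/-! ### Stieltjes constants as derivatives at `0` -/

lemma differentiable_hurwitzRegular (x : ℝ) : Differentiable ℂ (hurwitzRegular x) := by
  rw [← differentiableOn_univ]
  refine Complex.differentiableOn_update_limUnder_of_isLittleO univ_mem (fun s hs => ?_) ?_
  · have hs1 : s ≠ 1 := hs.2
    refine DifferentiableAt.differentiableWithinAt ?_
    have := HurwitzZeta.differentiableAt_hurwitzZeta (x : UnitAddCircle) hs1
    exact this.sub ((differentiableAt_const _).div (by fun_prop) (sub_ne_zero.mpr hs1))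
  -- the singularity is removable because `(s - 1) ζ(s, x)` tends to `1`
  · rw [Asymptotics.isLittleO_iff_tendsto' ?_]
    · have h1 : ∀ c : ℂ, Tendsto (fun s : ℂ => (s - 1) * hurwitz x s - 1 - (s - 1) * c)
          (𝓝[≠] 1) (𝓝 (1 - 1 - 0)) := by
        intro c
        refine ((HurwitzZeta.hurwitzZeta_residue_one _).sub_const 1).sub ?_
        refine Tendsto.mono_left ?_ nhdsWithin_le_nhds
        have : ContinuousAt (fun s : ℂ => (s - 1) * c) 1 := by fun_prop
        simpa [ContinuousAt] using this
      rw [sub_self, sub_zero] at h1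
      refine (h1 (hurwitz x 1 - 1 / (1 - 1))).congr' ?_
      filter_upwards [self_mem_nhdsWithin] with s hs
      have : s - 1 ≠ 0 := sub_ne_zero.mpr hs
      generalize hurwitz x 1 - 1 / (1 - 1) = c
      field_simp
    · filter_upwards [self_mem_nhdsWithin] with s hs h
      exact absurd h (inv_ne_zero (sub_ne_zero.mpr hs))

/-- The analytic continuation of `s ζ(1 - s, x)` to a neighbourhood of `0`. -/
noncomputable def hurwitzReflected (x : ℝ) (s : ℂ) : ℂ :=
  s * hurwitzRegular x (1 - s) - 1

lemma hurwitzReflected_eq (x : ℝ) {s : ℂ} (hs : s ≠ 0) :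
    hurwitzReflected x s = s * hurwitz x (1 - s) := by
  have h : (1 : ℂ) - s ≠ 1 := by simpa using hs
  rw [hurwitzReflected, hurwitzRegular, Function.update_of_ne h]
  field_simp
  ring

lemma analyticAt_hurwitzReflected (x : ℝ) : AnalyticAt ℂ (hurwitzReflected x) 0 := by
  have h : Differentiable ℂ (hurwitzReflected x) :=
    (differentiable_id.mul ((differentiable_hurwitzRegular x).comp
      ((differentiable_const 1).sub differentiable_id))).sub_const 1
  exact h.analyticAt 0

/-- The derivatives of `s f(s)` at `0`. -/
lemma iteratedDeriv_id_mul {f : ℂ → ℂ} (hf : AnalyticAt ℂ f 0) (n : ℕ) :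
    iteratedDeriv n (fun s => s * f s) 0 = n * iteratedDeriv (n - 1) f 0 := by
  rcases n with _ | n
  · simp
  rw [iteratedDeriv_fun_mul (f := fun s : ℂ => s) contDiffAt_id hf.contDiffAt, sum_range_succ',
    sum_range_succ']
  have : ∀ k ∈ range n, ((n + 1).choose (k + 1 + 1) : ℂ) *
      iteratedDeriv (k + 1 + 1) (fun s : ℂ => s) 0 *
        iteratedDeriv (n + 1 - (k + 1 + 1)) f 0 = 0 := by
    intro k _
    have h1 : deriv (fun s : ℂ => s) = fun _ => 1 := funext fun s => deriv_id s
    rw [iteratedDeriv_succ', h1, iteratedDeriv_const]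
    simp
  rw [sum_eq_zero this]
  simp

/-- The Stieltjes constants in terms of the values of the Hurwitz zeta function at `1 - s`. -/
lemma iteratedDeriv_hurwitzReflected (x : ℝ) {n : ℕ} (hn : 1 ≤ n) :
    iteratedDeriv n (hurwitzReflected x) 0 = n * stieltjes (n - 1) x := by
  have hR := differentiable_hurwitzRegular x
  have hR' : AnalyticAt ℂ (fun s => hurwitzRegular x (1 - s)) 0 :=
    (hR.comp ((differentiable_const (1 : ℂ)).sub differentiable_id)).analyticAt 0
  unfold hurwitzReflected
  obtain ⟨m, rfl⟩ : ∃ m, n = m + 1 := ⟨n - 1, by omega⟩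
  have h1 : deriv (fun s : ℂ => s * hurwitzRegular x (1 - s) - 1) =
      deriv (fun s : ℂ => s * hurwitzRegular x (1 - s)) := funext fun s => deriv_sub_const _
  rw [iteratedDeriv_succ', h1, ← iteratedDeriv_succ', iteratedDeriv_id_mul hR',
    iteratedDeriv_comp_const_sub]
  simp [stieltjes]

/-! ### The functional equation at a rational parameter -/

lemma sum_zmod_eq_sum_Icc {q : ℕ} [NeZero q] (f : ZMod q → ℂ) :
    ∑ k, f k = ∑ r ∈ Icc 1 q, f r := by
  have hq : 0 < q := NeZero.pos q
  symm
  refine sum_bij (fun r _ => (r : ZMod q)) (fun _ _ => mem_univ _) ?_ ?_ (fun _ _ => rfl)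
  · intro a ha b hb hab
    rw [mem_Icc] at ha hb
    have h := (ZMod.natCast_eq_natCast_iff' a b q).mp hab
    rcases ha.2.lt_or_eq with ha' | ha' <;> rcases hb.2.lt_or_eq with hb' | hb'
    · rwa [Nat.mod_eq_of_lt ha', Nat.mod_eq_of_lt hb'] at h
    · rw [Nat.mod_eq_of_lt ha', hb', Nat.mod_self] at h
      omega
    · rw [Nat.mod_eq_of_lt hb', ha', Nat.mod_self] at h
      omega
    · omega
  · intro k _
    rcases eq_or_ne k 0 with rfl | hk
    · exact ⟨q, mem_Icc.mpr ⟨hq, le_rfl⟩, by simp⟩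
    · refine ⟨k.val, mem_Icc.mpr ⟨?_, k.val_lt.le⟩, ZMod.natCast_zmod_val k⟩
      exact Nat.one_le_iff_ne_zero.mpr ((ZMod.val_ne_zero k).mpr hk)

/-- At a rational parameter the periodic zeta function is a combination of Hurwitz zeta functions
with roots of unity as coefficients. -/
lemma expZeta_eq_sum_hurwitz {q : ℕ} [NeZero q] (j : ℤ) {s : ℂ} (hs : s ≠ 1) :
    HurwitzZeta.expZeta ((j / q : ℝ) : UnitAddCircle) s = (q : ℂ) ^ (-s) *
      ∑ r ∈ Icc 1 q, Complex.exp (2 * Real.pi * Complex.I * (j * r) / q) *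
        hurwitz ((r : ℝ) / q) s := by
  rw [← ZMod.toAddCircle_intCast, ← ZMod.LFunction_stdAddChar_eq_expZeta _ _ (Or.inr hs),
    ZMod.LFunction, sum_zmod_eq_sum_Icc]
  congr 1
  refine sum_congr rfl fun r _ => ?_
  have h := ZMod.stdAddChar_coe (N := q) (j * r)
  push_cast at h
  rw [h, ZMod.toAddCircle_natCast, hurwitz]

/-- The Gamma factor `Γ(1 + s) (2πq) ^ (-s)` of the functional equation. -/
noncomputable def gammaFactor (q : ℕ) (s : ℂ) : ℂ :=
  Complex.Gamma (1 + s) * Complex.exp (-((Real.log (2 * Real.pi * q) : ℂ) * s))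

/-- The functional equation of the Hurwitz zeta function at a rational parameter. -/
lemma mul_hurwitz_one_sub {p q : ℕ} (hq : 0 < q) {s : ℂ} (hs : ∀ n : ℕ, s ≠ -n) (hs1 : s ≠ 1) :
    s * hurwitz ((p : ℝ) / q) (1 - s) = 2 * ∑ r ∈ Icc 1 q, gammaFactor q s *
      Complex.cos (Real.pi / 2 * s - (2 * Real.pi * r * p / q : ℝ)) * hurwitz ((r : ℝ) / q) s := by
  have : NeZero q := ⟨hq.ne'⟩
  have hs0 : s ≠ 0 := by simpa using hs 0
  have hq0 : (q : ℂ) ≠ 0 := Nat.cast_ne_zero.mpr hq.ne'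
  have hpi : (2 * Real.pi : ℂ) ≠ 0 := by simp [Real.pi_ne_zero]
  have hpow : (2 * Real.pi : ℂ) ^ (-s) * (q : ℂ) ^ (-s) =
      Complex.exp (-((Real.log (2 * Real.pi * q) : ℂ) * s)) := by
    have h2 : (2 * Real.pi : ℂ) = ((2 * Real.pi : ℝ) : ℂ) := by push_cast; rfl
    rw [Complex.cpow_def_of_ne_zero hpi, Complex.cpow_def_of_ne_zero hq0, ← Complex.exp_add,
      Real.log_mul (by positivity) (by positivity), h2, ← Complex.ofReal_log (by positivity),
      ← Complex.natCast_log]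
    congr 1
    push_cast
    ring
  have e1 := expZeta_eq_sum_hurwitz (q := q) (p : ℤ) hs1
  have e2 := expZeta_eq_sum_hurwitz (q := q) (-(p : ℤ)) hs1
  have hneg : (((-(p : ℤ) : ℤ) : ℝ) / q : ℝ) = -((p : ℝ) / q) := by push_cast; ring
  rw [hneg, AddCircle.coe_neg] at e2
  rw [Int.cast_natCast] at e1
  rw [hurwitz, HurwitzZeta.hurwitzZeta_one_sub _ hs (Or.inr hs1), e1, e2, gammaFactor, add_comm 1 s,
    Complex.Gamma_add_one s hs0, ← hpow]
  simp only [mul_sum, mul_add, ← sum_add_distrib]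
  refine sum_congr rfl fun r _ => ?_
  rw [Complex.cos]
  have h1 : Complex.exp ((Real.pi / 2 * s - (2 * Real.pi * r * p / q : ℝ)) * Complex.I) =
      Complex.exp (Real.pi * Complex.I * s / 2) *
        Complex.exp (2 * Real.pi * Complex.I * (((-(p : ℤ) : ℤ) : ℂ) * r) / q) := by
    rw [← Complex.exp_add]
    congr 1
    push_cast
    ring
  have h2 : Complex.exp (-(Real.pi / 2 * s - (2 * Real.pi * r * p / q : ℝ)) * Complex.I) =
      Complex.exp (-Real.pi * Complex.I * s / 2) *
        Complex.exp (2 * Real.pi * Complex.I * (((p : ℤ) : ℂ) * r) / q) := by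
    rw [← Complex.exp_add]
    congr 1
    push_cast
    ring
  rw [h1, h2]
  ring

lemma analyticAt_Gamma_of_re_pos {s : ℂ} (hs : 0 < s.re) : AnalyticAt ℂ Complex.Gamma s := by
  have h : DifferentiableOn ℂ Complex.Gamma {z | 0 < z.re} := fun z hz =>
    (Complex.differentiableAt_Gamma z fun m h => by
      have hz' : 0 < z.re := hz
      rw [h, Complex.neg_re, Complex.natCast_re] at hz'
      linarith [(Nat.cast_nonneg m : (0 : ℝ) ≤ m)]).differentiableWithinAt
  exact h.analyticAt ((isOpen_lt continuous_const Complex.continuous_re).mem_nhds hs)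

lemma analyticAt_gammaFactor (q : ℕ) : AnalyticAt ℂ (gammaFactor q) 0 := by
  have h : AnalyticAt ℂ (fun s => Complex.Gamma (1 + s)) 0 :=
    AnalyticAt.fun_comp (analyticAt_Gamma_of_re_pos (by simp)) (by fun_prop)
  unfold gammaFactor
  fun_prop

lemma analyticAt_hurwitz (x : ℝ) : AnalyticAt ℂ (hurwitz x) 0 := by
  have h : DifferentiableOn ℂ (hurwitz x) {1}ᶜ := fun s hs =>
    (HurwitzZeta.differentiableAt_hurwitzZeta _ hs).differentiableWithinAt
  exact h.analyticAt (isOpen_compl_singleton.mem_nhds (by simp))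

/-- The functional equation multiplied by `s` holds in a whole neighbourhood of `s = 0`. -/
lemma hurwitzReflected_eventuallyEq {p q : ℕ} (hq : 0 < q) :
    hurwitzReflected ((p : ℝ) / q) =ᶠ[𝓝 0] fun s => 2 * ∑ r ∈ Icc 1 q, gammaFactor q s *
      Complex.cos (Real.pi / 2 * s - (2 * Real.pi * r * p / q : ℝ)) * hurwitz ((r : ℝ) / q) s := by
  have han := analyticAt_gammaFactor q
  have hanz := fun r : ℕ => analyticAt_hurwitz ((r : ℝ) / q)
  refine ((analyticAt_hurwitzReflected _).frequently_eq_iff_eventually_eq ?_).mp ?_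
  · refine analyticAt_const.mul (Finset.analyticAt_fun_sum _ fun r _ => ?_)
    exact (han.mul (by fun_prop)).mul (hanz r)
  · refine Eventually.frequently ?_
    have hball : ∀ᶠ s in 𝓝[≠] (0 : ℂ), ‖s‖ < 1 :=
      nhdsWithin_le_nhds eventually_norm_lt_one
    filter_upwards [self_mem_nhdsWithin, hball] with s hs0 hs
    rw [hurwitzReflected_eq _ hs0]
    refine mul_hurwitz_one_sub hq (fun n hn => ?_) (by rintro rfl; simp at hs)
    rw [hn, norm_neg, Complex.norm_natCast, Nat.cast_lt_one] at hs
    exact hs0 (by simp [hn, hs])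

/-! ### The even and odd parts of the Gamma factor -/

lemma eventually_re_pos :
    ∀ᶠ s in 𝓝 (0 : ℂ), ‖s‖ < 1 ∧ 0 < (1 + s).re ∧ 0 < (1 - s).re ∧ 0 < (1 + s / 2).re ∧
      0 < (1 - s / 2).re := by
  filter_upwards [eventually_norm_lt_one] with s hs
  have h := abs_lt.mp ((Complex.abs_re_le_norm s).trans_lt hs)
  have h2 : (s / 2).re = s.re / 2 := by simp
  refine ⟨hs, ?_, ?_, ?_, ?_⟩ <;>
    simp only [Complex.add_re, Complex.sub_re, Complex.one_re, h2] <;> linarith [h.1, h.2]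

lemma hasDerivAt_Gamma_comp {u : ℂ → ℂ} {u' s : ℂ} (hu : HasDerivAt u u' s) (hs : 0 < (u s).re) :
    HasDerivAt (fun z => Complex.Gamma (u z))
      (u' * Complex.digamma (u s) * Complex.Gamma (u s)) s := by
  have h := (analyticAt_Gamma_of_re_pos hs).differentiableAt.hasDerivAt
  refine (h.comp s hu).congr_deriv ?_
  rw [Complex.digamma_def, logDeriv_apply]
  field_simp [Complex.Gamma_ne_zero_of_re_pos hs]

lemma analyticAt_digamma_comp {u : ℂ → ℂ} {s : ℂ} (hu : AnalyticAt ℂ u s) (hs : 0 < (u s).re) :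
    AnalyticAt ℂ (fun z => Complex.digamma (u z)) s := by
  have h := analyticAt_Gamma_of_re_pos hs
  exact AnalyticAt.fun_comp (h.deriv.div h (Complex.Gamma_ne_zero_of_re_pos hs)) hu

lemma analyticAt_gFun (q : ℕ) : AnalyticAt ℂ (gFun q) 0 := by
  have h1 := analyticAt_digamma_comp (u := fun s => 1 - s) (s := 0) (by fun_prop) (by simp)
  have h2 := analyticAt_digamma_comp (u := fun s => 1 + s / 2) (s := 0) (by fun_prop) (by simp)
  have h3 := analyticAt_digamma_comp (u := fun s => 1 - s / 2) (s := 0) (by fun_prop) (by simp)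
  unfold gFun
  fun_prop

lemma analyticAt_hFun (q : ℕ) : AnalyticAt ℂ (hFun q) 0 := by
  have h1 := analyticAt_digamma_comp (u := fun s => 1 + s) (s := 0) (by fun_prop) (by simp)
  have h2 := analyticAt_digamma_comp (u := fun s => 1 + s / 2) (s := 0) (by fun_prop) (by simp)
  have h3 := analyticAt_digamma_comp (u := fun s => 1 - s / 2) (s := 0) (by fun_prop) (by simp)
  unfold hFun
  fun_prop

/-- `Γ(1 + s / 2) Γ(1 - s / 2) (2πq) ^ (-s) / Γ(1 - s)`, which is `Γ(1 + s) (2πq) ^ (-s) cos (πs/2)`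
by the reflection formula. -/
noncomputable def evenFactor (q : ℕ) (s : ℂ) : ℂ :=
  Complex.Gamma (1 + s / 2) * Complex.Gamma (1 - s / 2) / Complex.Gamma (1 - s) *
    Complex.exp (-((Real.log (2 * Real.pi * q) : ℂ) * s))

/-- `Γ(1 + s) (2πq) ^ (-s) / (Γ(1 + s / 2) Γ(1 - s / 2))`, which is
`Γ(1 + s) (2πq) ^ (-s) sin (πs/2) / (πs/2)` by the reflection formula. -/
noncomputable def oddFactor (q : ℕ) (s : ℂ) : ℂ :=
  Complex.Gamma (1 + s) / (Complex.Gamma (1 + s / 2) * Complex.Gamma (1 - s / 2)) *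
    Complex.exp (-((Real.log (2 * Real.pi * q) : ℂ) * s))

lemma Gamma_one_add_mul_Gamma_one_sub {s : ℂ} (hs : s ≠ 0) :
    Complex.Gamma (1 + s) * Complex.Gamma (1 - s) =
      Real.pi * s / Complex.sin (Real.pi * s) := by
  rw [add_comm, Complex.Gamma_add_one s hs, mul_assoc, Complex.Gamma_mul_Gamma_one_sub]
  ring

lemma sin_pi_mul_ne_zero {s : ℂ} (hs0 : s ≠ 0) (hs : ‖s‖ < 1) : Complex.sin (Real.pi * s) ≠ 0 := by
  intro h
  obtain ⟨k, hk⟩ := Complex.sin_eq_zero_iff.mp h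
  have hpi : (Real.pi : ℂ) ≠ 0 := Complex.ofReal_ne_zero.mpr Real.pi_ne_zero
  have hsk : s = k := mul_left_cancel₀ hpi (by rw [hk, mul_comm])
  rw [hsk, Complex.norm_intCast] at hs
  have : k = 0 := by
    rw [← Int.abs_lt_one_iff]
    exact_mod_cast hs
  exact hs0 (by simp [hsk, this])

/-- The reflection formula `sin (πs/2) Γ(1 + s/2) Γ(1 - s/2) = πs/2`. -/
lemma sin_half_eq {s : ℂ} (hs0 : s ≠ 0) (hs : ‖s‖ < 1) :
    Complex.sin (Real.pi / 2 * s) * (Complex.Gamma (1 + s / 2) * Complex.Gamma (1 - s / 2)) =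
      Real.pi / 2 * s := by
  have h2 : s / 2 ≠ 0 := div_ne_zero hs0 two_ne_zero
  have hn : ‖s / 2‖ < 1 := by
    rw [norm_div, Complex.norm_ofNat]
    linarith [norm_nonneg s]
  have hsin := sin_pi_mul_ne_zero h2 hn
  rw [Gamma_one_add_mul_Gamma_one_sub h2,
    show (Real.pi / 2 * s : ℂ) = Real.pi * (s / 2) by ring, mul_div_cancel₀ _ hsin]

/-- The splitting `cos (πs/2 - θ) = cos θ cos (πs/2) + sin θ sin (πs/2)` with both trigonometric
factors in `s` written through the Gamma function. -/
lemma gammaFactor_mul_cos_sub (q : ℕ) (θ : ℂ) :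
    (fun s => gammaFactor q s * Complex.cos (Real.pi / 2 * s - θ)) =ᶠ[𝓝 0] fun s =>
      evenFactor q s * Complex.cos θ + s * (Real.pi / 2 * Complex.sin θ * oddFactor q s) := by
  filter_upwards [eventually_re_pos] with s ⟨hs, h1, h2, h3, h4⟩
  rcases eq_or_ne s 0 with rfl | hs0
  · simp [gammaFactor, evenFactor]
  have g1 := Complex.Gamma_ne_zero_of_re_pos h1
  have g2 := Complex.Gamma_ne_zero_of_re_pos h2
  have g3 := Complex.Gamma_ne_zero_of_re_pos h3
  have g4 := Complex.Gamma_ne_zero_of_re_pos h4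
  have hsin := sin_half_eq hs0 hs
  have hS : Complex.sin (Real.pi / 2 * s) ≠ 0 := by
    intro h
    rw [h, zero_mul] at hsin
    exact mul_ne_zero (by simp [Real.pi_ne_zero]) hs0 hsin.symm
  -- `cos (πs/2) = sin (πs) / (2 sin (πs/2))`, and both sines are quotients of Gamma values
  have hcos : Complex.Gamma (1 + s) * Complex.cos (Real.pi / 2 * s) =
      Complex.Gamma (1 + s / 2) * Complex.Gamma (1 - s / 2) / Complex.Gamma (1 - s) := by
    rw [eq_div_iff g2]
    have hd : Complex.sin (Real.pi * s) =
        2 * Complex.sin (Real.pi / 2 * s) * Complex.cos (Real.pi / 2 * s) := by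
      rw [← Complex.sin_two_mul]
      congr 1
      ring
    have hr := Gamma_one_add_mul_Gamma_one_sub hs0
    rw [eq_div_iff (sin_pi_mul_ne_zero hs0 hs), hd] at hr
    refine mul_left_cancel₀ hS ?_
    rw [hsin]
    linear_combination hr / 2
  have hsin' : Complex.Gamma (1 + s) * Complex.sin (Real.pi / 2 * s) =
      Real.pi / 2 * s * (Complex.Gamma (1 + s) /
        (Complex.Gamma (1 + s / 2) * Complex.Gamma (1 - s / 2))) := by
    rw [mul_div_assoc', eq_div_iff (mul_ne_zero g3 g4)]
    linear_combination Complex.Gamma (1 + s) * hsin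
  simp only [gammaFactor, evenFactor, oddFactor]
  rw [← hcos, Complex.cos_sub]
  linear_combination Complex.exp (-((Real.log (2 * Real.pi * q) : ℂ) * s)) * Complex.sin θ * hsin'

lemma hasDerivAt_one_sub (s : ℂ) : HasDerivAt (fun z : ℂ => 1 - z) (-1) s :=
  (hasDerivAt_id s).const_sub 1

lemma analyticAt_Gamma_comp {u : ℂ → ℂ} {s : ℂ} (hu : AnalyticAt ℂ u s) (hs : 0 < (u s).re) :
    AnalyticAt ℂ (fun z => Complex.Gamma (u z)) s :=
  AnalyticAt.fun_comp (analyticAt_Gamma_of_re_pos hs) hu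

lemma analyticAt_evenFactor (q : ℕ) : AnalyticAt ℂ (evenFactor q) 0 := by
  have h1 := analyticAt_Gamma_comp (u := fun s => 1 - s) (s := 0) (by fun_prop) (by simp)
  have h2 := analyticAt_Gamma_comp (u := fun s => 1 + s / 2) (s := 0) (by fun_prop) (by simp)
  have h3 := analyticAt_Gamma_comp (u := fun s => 1 - s / 2) (s := 0) (by fun_prop) (by simp)
  exact ((h2.mul h3).div h1 (Complex.Gamma_ne_zero_of_re_pos (by simp))).mul (by fun_prop)

lemma analyticAt_oddFactor (q : ℕ) : AnalyticAt ℂ (oddFactor q) 0 := by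
  have h1 := analyticAt_Gamma_comp (u := fun s => 1 + s) (s := 0) (by fun_prop) (by simp)
  have h2 := analyticAt_Gamma_comp (u := fun s => 1 + s / 2) (s := 0) (by fun_prop) (by simp)
  have h3 := analyticAt_Gamma_comp (u := fun s => 1 - s / 2) (s := 0) (by fun_prop) (by simp)
  exact (h1.div (h2.mul h3) (by simp)).mul (by fun_prop)

lemma hasDerivAt_cexp_neg_mul (c s : ℂ) :
    HasDerivAt (fun z => Complex.exp (-(c * z))) (-c * Complex.exp (-(c * s))) s := by
  have := ((hasDerivAt_id s).const_mul c).neg.cexp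
  simpa [mul_comm] using this

lemma iteratedDeriv_evenFactor (q i : ℕ) :
    iteratedDeriv i (evenFactor q) 0 = bellDerivZero i (gFun q) := by
  refine iteratedDeriv_eq_bellDerivZero (analyticAt_evenFactor q) (analyticAt_gFun q)
    (by simp [evenFactor]) ?_ i
  filter_upwards [eventually_re_pos] with s ⟨_, _, h2, h3, h4⟩
  have g2 := Complex.Gamma_ne_zero_of_re_pos h2
  have d2 := hasDerivAt_Gamma_comp (hasDerivAt_one_sub s) h2
  have d3 := hasDerivAt_Gamma_comp (((hasDerivAt_id s).div_const 2).const_add 1) h3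
  have d4 := hasDerivAt_Gamma_comp (((hasDerivAt_id s).div_const 2).const_sub 1) h4
  have d := ((d3.mul d4).div d2 g2).mul (hasDerivAt_cexp_neg_mul (Real.log (2 * Real.pi * q)) s)
  refine d.deriv.trans ?_
  simp only [gFun, evenFactor, id, Pi.mul_apply, Pi.div_apply]
  field_simp
  ring

lemma iteratedDeriv_oddFactor (q i : ℕ) :
    iteratedDeriv i (oddFactor q) 0 = bellDerivZero i (hFun q) := by
  refine iteratedDeriv_eq_bellDerivZero (analyticAt_oddFactor q) (analyticAt_hFun q)
    (by simp [oddFactor]) ?_ i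
  filter_upwards [eventually_re_pos] with s ⟨_, h1, _, h3, h4⟩
  have g3 := Complex.Gamma_ne_zero_of_re_pos h3
  have g4 := Complex.Gamma_ne_zero_of_re_pos h4
  have d1 := hasDerivAt_Gamma_comp ((hasDerivAt_id s).const_add 1) h1
  have d3 := hasDerivAt_Gamma_comp (((hasDerivAt_id s).div_const 2).const_add 1) h3
  have d4 := hasDerivAt_Gamma_comp (((hasDerivAt_id s).div_const 2).const_sub 1) h4
  have d := (d1.div (d3.mul d4) (mul_ne_zero g3 g4)).mul
    (hasDerivAt_cexp_neg_mul (Real.log (2 * Real.pi * q)) s)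
  refine d.deriv.trans ?_
  simp only [hFun, oddFactor, id, Pi.mul_apply, Pi.div_apply]
  field_simp
  ring

lemma iteratedDeriv_gammaFactor (q i : ℕ) :
    iteratedDeriv i (gammaFactor q) 0 = (-1) ^ i * bellStar q i := by
  rw [← iteratedDeriv_Gamma_one_sub_mul_cexp]
  have h := iteratedDeriv_comp_neg i (fun s => Complex.Gamma (1 - s) *
    Complex.exp ((Real.log (2 * Real.pi * q) : ℂ) * s)) 0
  rw [neg_zero, smul_eq_mul] at h
  rw [← h]
  congr 1
  ext s
  simp [gammaFactor]

lemma iteratedDeriv_cos_mul_sub (a θ : ℂ) (m : ℕ) :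
    iteratedDeriv m (fun s => Complex.cos (a * s - θ)) =
      fun s => a ^ m * Complex.cos (a * s - θ + Real.pi * m / 2) := by
  induction m with
  | zero => simp
  | succ m ih =>
    rw [iteratedDeriv_succ, ih]
    ext s
    have h : HasDerivAt (fun s : ℂ => a * s - θ + Real.pi * m / 2) a s := by
      simpa using (((hasDerivAt_id s).const_mul a).sub_const θ).add_const (Real.pi * m / 2 : ℂ)
    rw [(h.ccos.const_mul (a ^ m)).deriv]
    have h2 : a * s - θ + Real.pi * ((m + 1 : ℕ) : ℂ) / 2 =
        a * s - θ + Real.pi * m / 2 + Real.pi / 2 := by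
      push_cast
      ring
    rw [h2, Complex.cos_add_pi_div_two, pow_succ]
    ring

lemma cos_neg_add_pi_mul_nat_div_two (θ : ℝ) (m : ℕ) :
    Complex.cos (-(θ : ℂ) + Real.pi * m / 2) = (-1) ^ m * (Real.cos (θ + Real.pi * m / 2) : ℂ) := by
  have h : -(θ : ℂ) + Real.pi * m / 2 = -((θ : ℂ) + Real.pi * m / 2 - m * Real.pi) := by ring
  rw [h, Complex.cos_neg]
  exact_mod_cast congrArg Complex.ofReal (Real.cos_sub_nat_mul_pi (θ + Real.pi * m / 2) m)

/-! ### The formulas for the Stieltjes constants -/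

lemma iteratedDeriv_hurwitzReflected_eq_sum {p q : ℕ} (hq : 0 < q) (n : ℕ) :
    iteratedDeriv n (hurwitzReflected ((p : ℝ) / q)) 0 =
      2 * ∑ r ∈ Icc 1 q, iteratedDeriv n (fun s => gammaFactor q s *
        Complex.cos (Real.pi / 2 * s - (2 * Real.pi * r * p / q : ℝ)) *
          hurwitz ((r : ℝ) / q) s) 0 := by
  have han := analyticAt_gammaFactor q
  have hanz := fun r : ℕ => analyticAt_hurwitz ((r : ℝ) / q)
  rw [(hurwitzReflected_eventuallyEq hq).iteratedDeriv_eq, iteratedDeriv_const_mul_field,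
    iteratedDeriv_fun_sum]
  exact fun r _ => ((han.mul (by fun_prop)).mul (hanz r)).contDiffAt

lemma iteratedDeriv_gammaFactor_mul_cos (q i : ℕ) (θ : ℝ) :
    iteratedDeriv i (fun s => gammaFactor q s * Complex.cos (Real.pi / 2 * s - (θ : ℂ))) 0 =
      bellDerivZero i (gFun q) * (Real.cos θ : ℂ) +
        (Real.pi / 2 : ℂ) * (i : ℂ) * bellDerivZero (i - 1) (hFun q) * (Real.sin θ : ℂ) := by
  have he := analyticAt_evenFactor q
  have ho := analyticAt_oddFactor q
  rw [(gammaFactor_mul_cos_sub q θ).iteratedDeriv_eq, iteratedDeriv_fun_add,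
    iteratedDeriv_mul_const_field, iteratedDeriv_id_mul, iteratedDeriv_const_mul_field,
    iteratedDeriv_evenFactor, iteratedDeriv_oddFactor]
  · push_cast
    ring
  · fun_prop
  · exact (he.fun_mul analyticAt_const).contDiffAt
  · exact AnalyticAt.contDiffAt (by fun_prop)

lemma stieltjes_eq_sum_summand {p q n : ℕ} (hq : 0 < q) (hn : 1 ≤ n) :
    (n : ℂ) * stieltjes (n - 1) ((p : ℝ) / q) =
      2 * ∑ r ∈ Icc 1 q, ∑ i ∈ range (n + 1), summand n p q r i := by
  rw [← iteratedDeriv_hurwitzReflected _ hn, iteratedDeriv_hurwitzReflected_eq_sum hq]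
  congr 1
  refine sum_congr rfl fun r _ => ?_
  rw [iteratedDeriv_fun_mul ((analyticAt_gammaFactor q).fun_mul (by fun_prop)).contDiffAt
    (analyticAt_hurwitz _).contDiffAt]
  exact sum_congr rfl fun i _ => by rw [iteratedDeriv_gammaFactor_mul_cos]; rfl

lemma stieltjes_eq_sum_bellStar {p q n : ℕ} (hq : 0 < q) (hn : 1 ≤ n) :
    (n : ℂ) * stieltjes (n - 1) ((p : ℝ) / q) =
      2 * ∑ r ∈ Icc 1 q, ∑ i ∈ range (n + 1), (n.choose i : ℂ) * bellStar q i *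
        ∑ j ∈ range (n - i + 1),
          ((n - i).choose j : ℂ) * (-1) ^ (n - j) * (Real.pi / 2 : ℂ) ^ (n - i - j) *
            (Real.cos (2 * Real.pi * r * p / q + Real.pi * ((n - i - j : ℕ) : ℝ) / 2) : ℂ) *
            hurwitzDerivZero j ((r : ℝ) / q) := by
  rw [← iteratedDeriv_hurwitzReflected _ hn, iteratedDeriv_hurwitzReflected_eq_sum hq]
  congr 1
  refine sum_congr rfl fun r _ => ?_
  have hz := analyticAt_hurwitz ((r : ℝ) / q)
  simp only [mul_assoc (gammaFactor q _), mul_comm (Complex.cos _)]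
  rw [iteratedDeriv_fun_mul (analyticAt_gammaFactor q).contDiffAt
    (hz.fun_mul (by fun_prop)).contDiffAt]
  refine sum_congr rfl fun i hi => ?_
  rw [iteratedDeriv_fun_mul hz.contDiffAt (AnalyticAt.contDiffAt (by fun_prop)),
    iteratedDeriv_gammaFactor, mul_sum, mul_sum]
  refine sum_congr rfl fun j hj => ?_
  have hsign : ((-1 : ℂ)) ^ (n - j) = (-1) ^ i * (-1) ^ (n - i - j) := by
    rw [← pow_add]
    congr 1
    have := mem_range.mp hi
    have := mem_range.mp hj
    omega
  rw [iteratedDeriv_cos_mul_sub, hsign]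
  simp only [mul_zero, zero_sub]
  rw [cos_neg_add_pi_mul_nat_div_two, hurwitzDerivZero]
  ring

/-- In the summand with `r = q` the sine vanishes, and the result no longer depends on `p`. -/
lemma summand_self (n p i : ℕ) {q : ℕ} (hq : 0 < q) :
    summand n p q q i =
      (n.choose i : ℂ) * bellDerivZero i (gFun q) * iteratedDeriv (n - i) riemannZeta 0 := by
  have hq' : (q : ℝ) ≠ 0 := Nat.cast_ne_zero.mpr hq.ne'
  have hθ : 2 * Real.pi * q * p / q = p * (2 * Real.pi) := by
    field_simp
  have hz : hurwitz 1 = riemannZeta := by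
    ext s
    rw [hurwitz, AddCircle.coe_period, HurwitzZeta.hurwitzZeta_zero]
  have hsin : Real.sin (p * (2 * Real.pi)) = 0 := by
    simpa using Real.sin_nat_mul_two_pi_sub 0 p
  rw [summand, hθ, Real.cos_nat_mul_two_pi, hsin, div_self hq', hurwitzDerivZero, hz]
  push_cast
  ring

lemma stieltjes_eq_stieltjes_one_add {p q n : ℕ} (hq : 0 < q) (hn : 1 ≤ n) :
    (n : ℂ) * stieltjes (n - 1) ((p : ℝ) / q) = (n : ℂ) * stieltjes (n - 1) 1
      + 2 * ∑ i ∈ range (n + 1), (n.choose i : ℂ) *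
          (bellDerivZero i (gFun q) - bellDerivZero i (gFun 1)) * iteratedDeriv (n - i) riemannZeta 0
      + 2 * ∑ r ∈ Icc 1 (q - 1), ∑ i ∈ range (n + 1), summand n p q r i := by
  have h1 := stieltjes_eq_sum_summand (p := 1) one_pos hn
  rw [Nat.cast_one, div_one, Icc_self, sum_singleton] at h1
  obtain ⟨m, rfl⟩ : ∃ m, q = m + 1 := ⟨q - 1, by omega⟩
  rw [h1, stieltjes_eq_sum_summand hq hn, sum_Icc_succ_top (by omega), Nat.add_sub_cancel]
  simp only [summand_self _ _ _ hq, summand_self _ _ _ one_pos, mul_sub, sub_mul, sum_sub_distrib]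
  ring

end StieltjesRational

theorem mainTheorem1 (p q n : ℕ) (hp : 1 ≤ p) (hpq : p ≤ q) (hn : 1 ≤ n) :
    -- the double sum with Bell polynomials in the derivatives of `g` and `h`
    ((n : ℂ) * StieltjesRational.stieltjes (n - 1) ((p : ℝ) / q) =
      2 * ∑ r ∈ Finset.Icc 1 q, ∑ i ∈ Finset.range (n + 1),
        StieltjesRational.summand n p q r i) ∧
    -- the form with Bell polynomials in `γ + log (2πq)` and the values `ζ(2), ζ(3), …`
    ((n : ℂ) * StieltjesRational.stieltjes (n - 1) ((p : ℝ) / q) =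
      2 * ∑ r ∈ Finset.Icc 1 q, ∑ i ∈ Finset.range (n + 1),
        (n.choose i : ℂ) * StieltjesRational.bellStar q i *
          ∑ j ∈ Finset.range (n - i + 1),
            ((n - i).choose j : ℂ) * (-1) ^ (n - j) * (Real.pi / 2 : ℂ) ^ (n - i - j) *
              (Real.cos (2 * Real.pi * r * p / q + Real.pi * ((n - i - j : ℕ) : ℝ) / 2) : ℂ) *
              StieltjesRational.hurwitzDerivZero j ((r : ℝ) / q)) ∧
    -- the form obtained by subtracting the case `p = q = 1`
    ((n : ℂ) * StieltjesRational.stieltjes (n - 1) ((p : ℝ) / q) =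
      (n : ℂ) * StieltjesRational.stieltjes (n - 1) 1
      + 2 * ∑ i ∈ Finset.range (n + 1), (n.choose i : ℂ) *
          (StieltjesRational.bellDerivZero i (StieltjesRational.gFun q)
            - StieltjesRational.bellDerivZero i (StieltjesRational.gFun 1)) *
          iteratedDeriv (n - i) riemannZeta 0
      + 2 * ∑ r ∈ Finset.Icc 1 (q - 1), ∑ i ∈ Finset.range (n + 1),
        StieltjesRational.summand n p q r i) :=
  have hq : 0 < q := lt_of_lt_of_le hp hpq
  ⟨StieltjesRational.stieltjes_eq_sum_summand hq hn,
    StieltjesRational.stieltjes_eq_sum_bellStar hq hn,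
    StieltjesRational.stieltjes_eq_stieltjes_one_add hq hn⟩
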